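/- Let $\mathbb U=\{z\in\mathbb C:|z|<1\}$, let $p\ge 1$ be an integer, and let $\mathcal A_p$ be the class of analytic functions on $\mathbb U$ of the form $f(z)=z^p+\sum_{k\ge p+1}a_kz^k$. Let $(L_p^a)_{a\in\mathbb C}$ be a family of linear operators $\mathcal A_p\to\mathcal A_p$ (that is, compatible with the linear combinations that stay in $\mathcal A_p$), and $(\alpha_a)_{a\in\mathbb C}$ complex numbers, such that for all $a$ and all $f\in\mathcal A_p$ $$z\,(L_p^af)'(z)=\alpha_a L_p^{a+1}f(z)-(\alpha_a-p)L_p^af(z)\qquad(z\in\mathbb U).$$ For real $\mu,\nu$, not both zero, and $f\in\mathcal A_p$ put $$\Omega^a_{L,\mu,\nu}(f(z))=\left(\frac{L_p^{a+1}f(z)}{z^p}\right)^{\mu}\left(\frac{z^p}{L_p^{a}f(z)}\right)^{\nu},$$ with value $1$ at $z=0$; the powers are principal near the origin, and on $\mathbb U$ the expression denotes the analytic branch so determined, where there is one (the expression with principal powers otherwise). For analytic functions $g,h$ on $\mathbb U$ write $g\prec h$ if there is an analytic $w$ on $\mathbb U$ with $|w(z)|\le|z|$ and $g(z)=h(w(z))$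 for $z\in\mathbb U$. A function is univalent if it is analytic and injective on $\mathbb U$, and convex univalent if moreover its image of $\mathbb U$ is convex. $\mathcal H[1,1]$ is the class of analytic functions on $\mathbb U$ with value $1$ at $0$. $\mathcal Q$ is the class of functions $q$ that are analytic and injective on $\overline{\mathbb U}\setminus E(q)$, where $E(q)=\{\zeta\in\partial\mathbb U:\lim_{z\to\zeta,\,z\in\mathbb U}q(z)=\infty\}$, with $q'(\zeta)\ne0$ for $\zeta\in\partial\mathbb U\setminus E(q)$. Fix $a\in\mathbb C$, real $\mu,\nu$ not both zero, and $f\in\mathcal A_p$, and suppose that $\alpha_{a+1}\neq0$ and $\operatorname{Re}[\alpha_{a+1}\mu-\alpha_a\nu]\ge0$. Let $$\Phi(z)=\Omega^a_{L,\mu,\nu}(f(z))\left(\mu\,\Omega^{a+1}_{L,1,1}(f(z))-\frac{\alpha_a\nu}{\alpha_{a+1}}\,\Omega^{a}_{L,1,1}(f(z))\right).$$ Let $\psi_1,\psi_2$ be convex univalent in $\mathbb U$ with $\psi_1(0)=\psi_2(0)=1$, and for $j=1,2$ let $$\chi_j(z)=\frac1{\alpha_{a+1}}\left[(\alpha_{a+1}\mu-\alpha_a\nu)\psi_j(z)+z\psi_j'(z)\right].$$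 Suppose that $\Omega^a_{L,\mu,\nu}(f(z))$ has no zero in $\mathbb U$ and belongs to $\mathcal H[1,1]\cap\mathcal Q$, and that $\Phi$ is univalent in $\mathbb U$. If $\chi_1\prec\Phi\prec\chi_2$, then $$\psi_1(z)\prec\Omega^a_{L,\mu,\nu}(f(z))\prec\psi_2(z).$$ -/

import Mathlib

open Set Filter Topology

noncomputable section

namespace Sandwich

/-- The open unit disk. -/
def U : Set ℂ := Metric.ball (0 : ℂ) 1

/-- The class of functions `c + a_n z^n + a_{n+1} z^{n+1} + ⋯` analytic in the unit disk. Only the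
values on the disk matter, here and for every other class below. -/
def ClassH (c : ℂ) (n : ℕ) (f : ℂ → ℂ) : Prop :=
  DifferentiableOn ℂ f U ∧
    ∃ b : ℕ → ℂ, ∀ z ∈ U, HasSum (fun k : ℕ => b k * z ^ (n + k)) (f z - c)

/-- The class of functions `z^p + a_{p+1} z^{p+1} + ⋯` analytic in the unit disk. -/
def ClassA (p : ℕ) (f : ℂ → ℂ) : Prop :=
  DifferentiableOn ℂ f U ∧
    ∃ b : ℕ → ℂ, ∀ z ∈ U, HasSum (fun k : ℕ => b k * z ^ (p + 1 + k)) (f z - z ^ p)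

/-- Univalent in the unit disk: analytic and injective there. -/
def Univalent (f : ℂ → ℂ) : Prop :=
  DifferentiableOn ℂ f U ∧ InjOn f U

/-- Convex univalent in the unit disk: univalent with a convex image. -/
def ConvexUnivalent (f : ℂ → ℂ) : Prop :=
  Univalent f ∧ Convex ℝ (f '' U)

/-- Subordination `f ≺ g`, through a Schwarz function `w`. -/
def Subordinate (f g : ℂ → ℂ) : Prop :=
  ∃ w : ℂ → ℂ, DifferentiableOn ℂ w U ∧ (∀ z ∈ U, ‖w z‖ ≤ ‖z‖) ∧ ∀ z ∈ U, f z = g (w z)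

/-- The set `E(f)` of the boundary points of the disk at which `f` tends to infinity. -/
def exceptionalSet (f : ℂ → ℂ) : Set ℂ :=
  {ζ | ζ ∈ Metric.sphere (0 : ℂ) 1 ∧ Tendsto f (𝓝[U] ζ) (Bornology.cobounded ℂ)}

/-- The class `𝒬`: `f` is analytic and injective on the closed disk without `E(f)`, with
`f' ≠ 0` on the unit circle without `E(f)`. Since `f` is given on the open disk only, its values
at the boundary points are those of its analytic extension `g`. -/
def ClassQ (f : ℂ → ℂ) : Prop :=
  ∃ g : ℂ → ℂ, EqOn g f U ∧
    AnalyticOnNhd ℂ g (Metric.closedBall (0 : ℂ) 1 \ exceptionalSet f) ∧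
    InjOn g (Metric.closedBall (0 : ℂ) 1 \ exceptionalSet f) ∧
    ∀ ζ ∈ Metric.sphere (0 : ℂ) 1 \ exceptionalSet f, deriv g ζ ≠ 0

/-- The class `O_p` of families `L^a` of linear operators on `A_p` with
`z (L^a f)' = α_a L^{a+1} f - (α_a - p) L^a f`.
As `A_p` is an affine space that does not contain `0`, linearity is compatibility with the linear
combinations that stay in `A_p`. The case `c = 1` says that `L^a f` depends, on the disk, on the
values of `f` on the disk only. -/
structure ClassO (p : ℕ) (L : ℂ → (ℂ → ℂ) → (ℂ → ℂ)) (α : ℂ → ℂ) : Prop where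
  mapsTo : ∀ (a : ℂ) (f : ℂ → ℂ), ClassA p f → ClassA p (L a f)
  linear : ∀ (a c : ℂ) (f g h : ℂ → ℂ), ClassA p f → ClassA p g → ClassA p h →
    (∀ z ∈ U, h z = c * f z + (1 - c) * g z) →
    ∀ z ∈ U, L a h z = c * L a f z + (1 - c) * L a g z
  recurrence : ∀ (a : ℂ) (f : ℂ → ℂ), ClassA p f → ∀ z ∈ U,
    z * deriv (L a f) z = α a * L (a + 1) f z - (α a - p) * L a f z

/-- `(L^{a+1} f(z) / z^p)^μ (z^p / L^a f(z))^ν` with principal powers; the singularity at the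
origin is removable, with value `1`. -/
def principalOmega (p : ℕ) (L : ℂ → (ℂ → ℂ) → (ℂ → ℂ)) (μ ν : ℝ) (a : ℂ) (f : ℂ → ℂ)
    (z : ℂ) : ℂ :=
  open Classical in
  if z = 0 then 1
  else (L (a + 1) f z / z ^ p) ^ (μ : ℂ) * (z ^ p / L a f z) ^ (ν : ℂ)

open Classical in
/-- `Ω^a_{L,μ,ν}(f)`: the branch, analytic in the whole disk, of the expression `principalOmega`
which is given by the principal powers near the origin. It is unique on the disk
(`omega_eqOn`); in particular it is `principalOmega` itself if that is analytic in the disk. If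
there is no such branch, it is `principalOmega`. -/
def omega (p : ℕ) (L : ℂ → (ℂ → ℂ) → (ℂ → ℂ)) (μ ν : ℝ) (a : ℂ) (f : ℂ → ℂ) : ℂ → ℂ :=
  if h : ∃ q : ℂ → ℂ, DifferentiableOn ℂ q U ∧ q =ᶠ[𝓝 0] principalOmega p L μ ν a f
  then h.choose
  else principalOmega p L μ ν a f

theorem omega_eventuallyEq (p : ℕ) (L : ℂ → (ℂ → ℂ) → (ℂ → ℂ)) (μ ν : ℝ) (a : ℂ) (f : ℂ → ℂ) :
    omega p L μ ν a f =ᶠ[𝓝 0] principalOmega p L μ ν a f := by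
  unfold omega
  split_ifs with h
  · exact h.choose_spec.2
  · exact EventuallyEq.rfl

theorem omega_eqOn (p : ℕ) (L : ℂ → (ℂ → ℂ) → (ℂ → ℂ)) (μ ν : ℝ) (a : ℂ) (f q : ℂ → ℂ)
    (hq : DifferentiableOn ℂ q U) (h0 : q =ᶠ[𝓝 0] principalOmega p L μ ν a f) :
    EqOn (omega p L μ ν a f) q U := by
  have h : ∃ q : ℂ → ℂ, DifferentiableOn ℂ q U ∧ q =ᶠ[𝓝 0] principalOmega p L μ ν a f :=
    ⟨q, hq, h0⟩
  have hd : DifferentiableOn ℂ (omega p L μ ν a f) U := by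
    unfold omega
    rw [dif_pos h]
    exact h.choose_spec.1
  have ho : IsOpen U := Metric.isOpen_ball
  exact (hd.analyticOnNhd ho).eqOn_of_preconnected_of_eventuallyEq (hq.analyticOnNhd ho)
    (convex_ball (0 : ℂ) 1).isPreconnected (Metric.mem_ball_self one_pos)
    ((omega_eventuallyEq p L μ ν a f).trans h0.symm)

/-- `Υ_L = μ Ω^{a+1}_{L,1,1}(f) - (α_a ν / α_{a+1}) Ω^a_{L,1,1}(f)`. -/
def upsilon (p : ℕ) (L : ℂ → (ℂ → ℂ) → (ℂ → ℂ)) (α : ℂ → ℂ) (μ ν : ℝ) (a : ℂ) (f : ℂ → ℂ)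
    (z : ℂ) : ℂ :=
  μ * omega p L 1 1 (a + 1) f z - α a * ν / α (a + 1) * omega p L 1 1 a f z

/-- `Φ = Ω^a_{L,μ,ν}(f) Υ_L`. -/
def phi (p : ℕ) (L : ℂ → (ℂ → ℂ) → (ℂ → ℂ)) (α : ℂ → ℂ) (μ ν : ℝ) (a : ℂ) (f : ℂ → ℂ)
    (z : ℂ) : ℂ :=
  omega p L μ ν a f z * upsilon p L α μ ν a f z

/-- `χ = [(α_{a+1} μ - α_a ν) ψ + z ψ'] / α_{a+1}`. -/
def chi (α : ℂ → ℂ) (μ ν : ℝ) (a : ℂ) (ψ : ℂ → ℂ) (z : ℂ) : ℂ :=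
  1 / α (a + 1) * ((α (a + 1) * μ - α a * ν) * ψ z + z * deriv ψ z)

end Sandwich

end

/-!
Let `q = Ω` and `γ = α_{a+1} μ - α_a ν`. The logarithmic derivative of `Ω` and the recurrence for
`L^a` give `α_{a+1} Φ = γ q + z q'` (`mul_phi_eqOn`), so the theorem is about first-order
differential subordinations: for convex `ψ` and `Re γ ≥ 0`, compare `q` with `ψ` when `γ q + z q'`
is compared with `γ ψ + z ψ'`.

The geometric input is that `z ↦ ψ z - ψ (x z)` is starlike for convex `ψ`, that is
`Re ((ζ ψ' ζ - ξ ψ' ξ) / (ψ ζ - ψ ξ)) > 0` for `|ξ| < |ζ|` (`ConvexUnivalent.re_sub_div_sub_pos`).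
For `|ξ| = |ζ|` the weak inequality is the sum of two supporting-line inequalities for the convex
image of a disk, and the minimum principle in `x = ξ / ζ` gives the rest. Consequently the functions
`γ ψ + s z ψ'`, `s > 0`, form a subordination chain: `ConvexUnivalent.chain_ne` says that values are
not taken later at points of larger modulus, and `ConvexUnivalent.exists_chain_eq` that the images
increase.

Both subordinations are then proved by contradiction at a first exit point `z₀`, where Jack's lemma
(`exists_one_le_mul_deriv_eq`) compares derivatives up to a factor `m ≥ 1`. If `q` leaves
`ψ (|z| < r)`, then `γ q + z q'` at `z₀` is the member `s = m` of the chain of `ψ` at a point of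
modulus `r > |z₀|`, which contradicts `chain_ne`. If `ψ` leaves `q (U)`, the boundary behaviour of
the class `𝒬` provides a boundary point `ζ` at which `γ q + z q'` takes as boundary value the member
`s = 1 / m` of the chain at `z₀`. That is a value of `γ ψ + z ψ'`, hence of `γ q + z q'` in the disk,
which the open mapping theorem excludes for a univalent function.
-/

/-! ### Injective analytic functions -/

/-- Near a critical point `f - f z₀` is the `n`-th power, `n ≥ 2`, of a local coordinate `h`, so `f`
takes the same value at two points whose coordinates differ by an `n`-th root of unity. -/
theorem deriv_ne_zero_of_injOn {f : ℂ → ℂ} {V : Set ℂ} (hV : IsOpen V)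
    (hf : DifferentiableOn ℂ f V) (hinj : InjOn f V) {z₀ : ℂ} (hz₀ : z₀ ∈ V) :
    deriv f z₀ ≠ 0 := by
  intro hd
  have hVn : V ∈ 𝓝 z₀ := hV.mem_nhds hz₀
  have hfa : AnalyticAt ℂ f z₀ := hf.analyticAt hVn
  have hFa : AnalyticAt ℂ (fun z => f z - f z₀) z₀ := hfa.sub analyticAt_const
  have hnc : ¬ ∀ᶠ z in 𝓝 z₀, f z - f z₀ = 0 := by
    intro h
    obtain ⟨z, ⟨h1, h2⟩, h3⟩ :=
      ((h.and hVn).filter_mono nhdsWithin_le_nhds |>.and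
        (self_mem_nhdsWithin : {z₀}ᶜ ∈ 𝓝[≠] z₀)).exists
    exact h3 (hinj h2 hz₀ (sub_eq_zero.1 h1))
  obtain ⟨n, g, hga, hg0, hgE⟩ := hFa.exists_eventuallyEq_pow_smul_nonzero_iff.2 hnc
  have hE0 := hgE.self_of_nhds
  have hn0 : n ≠ 0 := by
    rintro rfl
    simp at hE0
    exact hg0 hE0.symm
  have hn1 : n ≠ 1 := by
    rintro rfl
    have h1 : HasDerivAt (fun z => (z - z₀) ^ 1 • g z)
        (1 * g z₀ + (z₀ - z₀) * deriv g z₀) z₀ := by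
      have := ((hasDerivAt_id z₀).sub_const z₀).mul hga.differentiableAt.hasDerivAt
      simpa using! this
    have h2 := (h1.congr_of_eventuallyEq hgE).deriv
    rw [deriv_sub_const, hd] at h2
    apply hg0
    simpa using h2.symm
  -- `h` is a local analytic `n`-th root of `f - f z₀`, with a simple zero at `z₀`
  set h : ℂ → ℂ := fun z => (z - z₀) * (g z₀ ^ (1 / n : ℂ) * (g z / g z₀) ^ (1 / n : ℂ)) with hh
  have hnC : (n : ℂ) ≠ 0 := by exact_mod_cast hn0
  have hha : AnalyticAt ℂ h z₀ := by
    refine (analyticAt_id.sub analyticAt_const).mul (analyticAt_const.mul ?_)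
    refine (hga.div analyticAt_const hg0).cpow analyticAt_const ?_
    simp [hg0]
  have hhpow : ∀ z, g z ≠ 0 → h z ^ n = (z - z₀) ^ n * g z := by
    intro z hz
    simp only [hh, mul_pow]
    rw [one_div, Complex.cpow_nat_inv_pow _ hn0, Complex.cpow_nat_inv_pow _ hn0]
    field_simp
  have hhd : deriv h z₀ = g z₀ ^ (1 / n : ℂ) := by
    have hk : AnalyticAt ℂ (fun z => g z₀ ^ (1 / n : ℂ) * (g z / g z₀) ^ (1 / n : ℂ)) z₀ :=
      analyticAt_const.mul ((hga.div analyticAt_const hg0).cpow analyticAt_const (by simp [hg0]))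
    have := (((hasDerivAt_id z₀).sub_const z₀).mul hk.differentiableAt.hasDerivAt).deriv
    simp only [id, sub_self, zero_mul, add_zero, one_mul, div_self hg0, Complex.one_cpow,
      mul_one] at this
    exact this
  have hhd0 : deriv h z₀ ≠ 0 := by
    rw [hhd]
    simp [Complex.cpow_eq_zero_iff, hg0]
  have hmap := hha.hasStrictDerivAt.map_nhds_eq hhd0
  have hh0 : h z₀ = 0 := by simp [hh]
  rw [hh0] at hmap
  have hN : ∀ᶠ z in 𝓝 z₀, z ∈ V ∧ f z - f z₀ = h z ^ n := by
    filter_upwards [hVn, hgE, hga.continuousAt.eventually_ne hg0] with z h1 h2 h3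
    refine ⟨h1, ?_⟩
    rw [h2, hhpow z h3, smul_eq_mul]
  have hI : h '' {z | z ∈ V ∧ f z - f z₀ = h z ^ n} ∈ 𝓝 (0 : ℂ) := by
    rw [← hmap]; exact image_mem_map hN
  set ω : ℂ := Complex.exp (2 * Real.pi * Complex.I / n) with hω
  have hprim : IsPrimitiveRoot ω n := Complex.isPrimitiveRoot_exp n hn0
  have hωc : Tendsto (fun t : ℂ => ω * t) (𝓝 0) (𝓝 0) := by
    have : Continuous fun t : ℂ => ω * t := by fun_prop
    simpa using! this.tendsto 0
  have hev : ∀ᶠ t in 𝓝[≠] (0 : ℂ), (t ∈ h '' {z | z ∈ V ∧ f z - f z₀ = h z ^ n} ∧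
      ω * t ∈ h '' {z | z ∈ V ∧ f z - f z₀ = h z ^ n}) ∧ t ≠ 0 :=
    (((eventually_mem_set.2 hI).and (hωc.eventually_mem hI)).filter_mono nhdsWithin_le_nhds).and
      self_mem_nhdsWithin
  obtain ⟨t, ⟨⟨z₁, ⟨hz₁, hz₁'⟩, h1⟩, ⟨z₂, ⟨hz₂, hz₂'⟩, h2⟩⟩, ht⟩ := hev.exists
  have heq : f z₁ = f z₂ := by
    have : f z₁ - f z₀ = f z₂ - f z₀ := by
      rw [hz₁', hz₂', h1, h2, mul_pow, hprim.pow_eq_one, one_mul]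
    exact sub_left_inj.1 this
  have hz := hinj hz₁ hz₂ heq
  rw [hz, h2] at h1
  have hω1 : ω = 1 := mul_right_cancel₀ ht (by rw [h1, one_mul])
  exact hprim.ne_one (by omega) hω1

theorem nhds_le_map_of_injOn {f : ℂ → ℂ} {V : Set ℂ} (hV : IsOpen V)
    (hf : DifferentiableOn ℂ f V) (hinj : InjOn f V) {z : ℂ} (hz : z ∈ V) :
    𝓝 (f z) ≤ map f (𝓝 z) :=
  ((hf.analyticAt (hV.mem_nhds hz)).hasStrictDerivAt.map_nhds_eq
    (deriv_ne_zero_of_injOn hV hf hinj hz)).ge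

theorem isOpen_image_of_injOn {f : ℂ → ℂ} {V : Set ℂ} (hV : IsOpen V)
    (hf : DifferentiableOn ℂ f V) (hinj : InjOn f V) : IsOpen (f '' V) := by
  refine isOpen_iff_mem_nhds.2 ?_
  rintro _ ⟨z, hz, rfl⟩
  exact nhds_le_map_of_injOn hV hf hinj hz (image_mem_map (hV.mem_nhds hz))

theorem exists_hasDerivAt_leftInverse_of_injOn {f : ℂ → ℂ} {V : Set ℂ} (hV : IsOpen V)
    (hf : DifferentiableOn ℂ f V) (hinj : InjOn f V) :
    ∃ k : ℂ → ℂ, (∀ z ∈ V, k (f z) = z) ∧ ∀ z ∈ V, HasDerivAt k (deriv f z)⁻¹ (f z) := by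
  have hk : ∀ z ∈ V, Function.invFunOn f V (f z) = z := fun z hz => hinj.leftInvOn_invFunOn hz
  refine ⟨Function.invFunOn f V, hk, fun z hz => ?_⟩
  have hfz : HasDerivAt f (deriv f z) (Function.invFunOn f V (f z)) := by
    rw [hk z hz]
    exact (hf.differentiableAt (hV.mem_nhds hz)).hasDerivAt
  refine HasDerivAt.of_local_left_inverse ?_ hfz (deriv_ne_zero_of_injOn hV hf hinj hz) ?_
  · rw [ContinuousAt, hk z hz]
    refine Tendsto.mono_left ?_ (nhds_le_map_of_injOn hV hf hinj hz)
    rw [tendsto_map'_iff]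
    refine tendsto_id.congr' ?_
    filter_upwards [hV.mem_nhds hz] with y hy
    exact (hk y hy).symm
  · filter_upwards [(isOpen_image_of_injOn hV hf hinj).mem_nhds (mem_image_of_mem f hz)]
    rintro _ ⟨y, hy, rfl⟩
    rw [hk y hy]

/-! ### Boundary derivatives -/

theorem HasDerivAt.nonpos_of_eventually_le {u : ℝ → ℝ} {u' x : ℝ} (hu : HasDerivAt u u' x)
    (h : ∀ᶠ t in 𝓝[>] x, u t ≤ u x) : u' ≤ 0 := by
  have h1 : Tendsto (slope u x) (𝓝[>] x) (𝓝 u') :=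
    (hasDerivAt_iff_tendsto_slope.1 hu).mono_left
      (nhdsWithin_mono _ fun y (hy : x < y) => ne_of_gt hy)
  refine le_of_tendsto h1 ?_
  filter_upwards [h, self_mem_nhdsWithin] with t ht (hxt : x < t)
  rw [slope_def_field]
  exact div_nonpos_of_nonpos_of_nonneg (by linarith) (by linarith)

theorem HasDerivAt.normSq {φ : ℝ → ℂ} {φ' : ℂ} {x : ℝ} (h : HasDerivAt φ φ' x) :
    HasDerivAt (fun t => Complex.normSq (φ t)) (2 * (φ' * (starRingEnd ℂ) (φ x)).re) x := by
  have hr : HasDerivAt (fun t => (φ t).re) φ'.re x :=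
    (Complex.reCLM.hasFDerivAt.comp_hasDerivAt x h)
  have hi : HasDerivAt (fun t => (φ t).im) φ'.im x :=
    (Complex.imCLM.hasFDerivAt.comp_hasDerivAt x h)
  refine ((hr.mul hr).add (hi.mul hi)).congr_deriv ?_
  simp [Complex.mul_re]
  ring

/-- **Jack's lemma**: if `‖w z‖ / ‖z‖` does not exceed its value at `z₀` as `z` approaches `z₀` from
the disk `‖z‖ < ‖z₀‖`, then `z₀ * w' z₀ / w z₀` is real and at least `1`. Differentiability is needed
at `z₀` only, so the point may lie on the boundary of the domain where the bound is known. -/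
theorem exists_one_le_mul_deriv_eq {w : ℂ → ℂ} {z₀ : ℂ} (hz₀ : z₀ ≠ 0)
    (hw : DifferentiableAt ℂ w z₀) (hw₀ : w z₀ ≠ 0)
    (h : ∀ᶠ z in 𝓝 z₀, ‖z‖ < ‖z₀‖ → ‖w z‖ * ‖z₀‖ ≤ ‖w z₀‖ * ‖z‖) :
    ∃ m : ℝ, 1 ≤ m ∧ z₀ * deriv w z₀ = m * w z₀ := by
  set d : ℂ := z₀ * deriv w z₀ / w z₀ with hd
  have key : ∀ b : ℂ, b.re < 0 → (d * b).re ≤ b.re := by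
    intro b hb
    have hl : HasDerivAt (fun t : ℝ => z₀ * (1 + t * b)) (z₀ * b) 0 := by
      have := (((Complex.ofRealCLM.hasDerivAt (x := (0 : ℝ))).mul_const b).const_add 1).const_mul z₀
      simpa using! this
    have hl0 : z₀ * (1 + ((0 : ℝ) : ℂ) * b) = z₀ := by simp
    have hw1 : HasDerivAt w (deriv w z₀) (z₀ * (1 + ((0 : ℝ) : ℂ) * b)) := by
      rw [hl0]; exact hw.hasDerivAt
    have hwl : HasDerivAt (fun t : ℝ => w (z₀ * (1 + t * b))) (deriv w z₀ * (z₀ * b)) 0 :=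
      HasDerivAt.comp (h₂ := w) (0 : ℝ) hw1 hl
    have hN := hwl.normSq.mul_const (Complex.normSq z₀) |>.sub
      (hl.normSq.const_mul (Complex.normSq (w z₀)))
    have hneg := hN.nonpos_of_eventually_le ?_
    · simp only [hl0] at hneg
      have e1 : deriv w z₀ * (z₀ * b) * (starRingEnd ℂ) (w z₀)
          = (Complex.normSq (w z₀) : ℂ) * (d * b) := by
        rw [Complex.normSq_eq_conj_mul_self, hd]
        field_simp
      have e2 : z₀ * b * (starRingEnd ℂ) z₀ = (Complex.normSq z₀ : ℂ) * b := by
        rw [Complex.normSq_eq_conj_mul_self]; ring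
      rw [e1, e2, Complex.re_ofReal_mul, Complex.re_ofReal_mul] at hneg
      have p1 := Complex.normSq_pos.2 hw₀
      have p2 := Complex.normSq_pos.2 hz₀
      have p3 : Complex.normSq (w z₀) * Complex.normSq z₀ * ((d * b).re - b.re) ≤ 0 := by
        linarith
      have := nonpos_of_mul_nonpos_right p3 (mul_pos p1 p2)
      linarith
    · have hlt : Tendsto (fun t : ℝ => z₀ * (1 + t * b)) (𝓝[>] 0) (𝓝 z₀) := by
        have := hl.continuousAt.tendsto.mono_left (nhdsWithin_le_nhds (s := Ioi 0))
        rwa [hl0] at this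
      have hsmall : ∀ᶠ t : ℝ in 𝓝[>] 0, t * Complex.normSq b < -2 * b.re := by
        have : Tendsto (fun t : ℝ => t * Complex.normSq b) (𝓝[>] 0) (𝓝 (0 * Complex.normSq b)) :=
          ((continuous_id.mul continuous_const).tendsto 0).mono_left nhdsWithin_le_nhds
        exact this.eventually_lt_const (by linarith)
      filter_upwards [hlt.eventually h, hsmall, self_mem_nhdsWithin] with t ht hts (ht0 : 0 < t)
      have hn : Complex.normSq (1 + t * b) < 1 := by
        rw [Complex.normSq_apply]
        rw [Complex.normSq_apply] at hts
        simp
        nlinarith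
      have hlt1 : ‖1 + t * b‖ < 1 := by
        rw [Complex.normSq_eq_norm_sq] at hn
        exact (sq_lt_one_iff₀ (norm_nonneg _)).1 hn
      have := ht (by
        rw [norm_mul]
        exact mul_lt_of_lt_one_right (norm_pos_iff.2 hz₀) hlt1)
      have h2 := mul_self_le_mul_self (by positivity) this
      simp only [hl0, Pi.sub_apply, Complex.normSq_eq_norm_sq]
      nlinarith
  have hre : 1 ≤ d.re := by
    have := key (-1) (by simp)
    simp at this
    exact this
  have him : d.im = 0 := by
    -- directions almost tangent to the circle exclude an imaginary part
    by_contra hne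
    have k1 : ∀ ε : ℝ, 0 < ε → |d.im| ≤ ε * (d.re - 1) := by
      intro ε hε
      have a1 := key ⟨-ε, 1⟩ (by simpa using hε)
      have a2 := key ⟨-ε, -1⟩ (by simpa using hε)
      simp [Complex.mul_re] at a1 a2
      rw [abs_le]
      constructor <;> linarith
    have h0 : 0 < |d.im| := abs_pos.2 hne
    have := k1 (|d.im| / (2 * d.re)) (by positivity)
    have h3 : |d.im| / (2 * d.re) * (d.re - 1) ≤ |d.im| / 2 := by
      rw [div_mul_eq_mul_div, div_le_div_iff₀ (by positivity) (by positivity)]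
      nlinarith
    linarith
  refine ⟨d.re, hre, ?_⟩
  have : (d.re : ℂ) = d := by
    apply Complex.ext <;> simp [him]
  rw [this, hd]
  field_simp

namespace Sandwich

/-! ### Convex univalent functions -/

theorem isOpen_U : IsOpen U := Metric.isOpen_ball

theorem isPreconnected_U : IsPreconnected U := (convex_ball (0 : ℂ) 1).isPreconnected

theorem mem_U_iff {z : ℂ} : z ∈ U ↔ ‖z‖ < 1 := mem_ball_zero_iff

theorem zero_mem_U : (0 : ℂ) ∈ U := Metric.mem_ball_self one_pos

/-- At a boundary point `ψ ζ` of the convex set `ψ (|z| < |ζ|)`, the outer normal `ζ * ψ' ζ` makes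
no obtuse angle with the vector from any point `ψ ξ` of the set. The convexity of that set is used
in the form that `(1 - t) * ψ z + t * ψ (ξ / ζ * z)` is subordinate to `ψ`. -/
theorem ConvexUnivalent.re_mul_deriv_div_sub_nonneg {ψ : ℂ → ℂ} (hψ : ConvexUnivalent ψ)
    {ζ ξ : ℂ} (hζ : ζ ∈ U) (hξ : ‖ξ‖ ≤ ‖ζ‖) :
    0 ≤ (ζ * deriv ψ ζ / (ψ ζ - ψ ξ)).re := by
  rcases eq_or_ne ζ 0 with rfl | hζ0
  · simp
  obtain ⟨k, hk, hkd⟩ := exists_hasDerivAt_leftInverse_of_injOn isOpen_U hψ.1.1 hψ.1.2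
  have hd0 := deriv_ne_zero_of_injOn isOpen_U hψ.1.1 hψ.1.2 hζ
  set x : ℂ := ξ / ζ with hx
  have hx1 : ‖x‖ ≤ 1 := by
    rw [hx, norm_div]
    exact div_le_one_of_le₀ hξ (norm_nonneg _)
  have hxU : ∀ z ∈ U, x * z ∈ U := by
    intro z hz
    rw [mem_U_iff] at hz ⊢
    rw [norm_mul]
    exact (mul_le_of_le_one_left (norm_nonneg _) hx1).trans_lt hz
  have hxζ : x * ζ = ξ := by rw [hx]; field_simp
  have himg : ∀ t ∈ Icc (0 : ℝ) 1, ∀ z ∈ U, (1 - t : ℝ) • ψ z + t • ψ (x * z) ∈ ψ '' U :=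
    fun t ht z hz => hψ.2 (mem_image_of_mem ψ hz) (mem_image_of_mem ψ (hxU z hz))
      (by linarith [ht.2]) ht.1 (by ring)
  have hle : ∀ t ∈ Icc (0 : ℝ) 1, ‖k ((1 - t : ℝ) • ψ ζ + t • ψ (x * ζ))‖ ≤ ‖ζ‖ := by
    intro t ht
    refine Complex.norm_le_norm_of_mapsTo_ball (R := 1)
      (f := fun z => k ((1 - t : ℝ) • ψ z + t • ψ (x * z))) ?_ ?_ ?_ (mem_U_iff.1 hζ)
    · intro z hz
      obtain ⟨y, hy, hyz⟩ := himg t ht z hz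
      have h1 : DifferentiableAt ℂ k ((1 - t : ℝ) • ψ z + t • ψ (x * z)) := by
        have h1' := (hkd y hy).differentiableAt
        rwa [hyz] at h1'
      have h2 : DifferentiableAt ℂ ψ z := hψ.1.1.differentiableAt (isOpen_U.mem_nhds hz)
      have h3 : DifferentiableAt ℂ ψ (x * z) :=
        hψ.1.1.differentiableAt (isOpen_U.mem_nhds (hxU z hz))
      have h4 : DifferentiableAt ℂ (fun z => ψ (x * z)) z :=
        h3.comp z (differentiableAt_id.const_mul x)
      exact (h1.comp z ((h2.const_smul (1 - t : ℝ)).add (h4.const_smul t))).differentiableWithinAt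
    · intro z hz
      obtain ⟨y, hy, hyz⟩ := himg t ht z hz
      simp only [← hyz, hk y hy]
      exact Metric.ball_subset_closedBall hy
    · have : (1 - t : ℝ) • ψ 0 + t • ψ (x * 0) = ψ 0 := by
        rw [mul_zero, ← add_smul]; simp
      simp only [this]
      exact hk 0 zero_mem_U
  -- `‖φ t‖` is maximal at `t = 0`, hence its derivative there is not positive
  set φ : ℝ → ℂ := fun t => k (ψ ζ + t * (ψ ξ - ψ ζ)) with hφ
  have hl0 : ψ ζ + ((0 : ℝ) : ℂ) * (ψ ξ - ψ ζ) = ψ ζ := by simp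
  have hφ0 : φ 0 = ζ := by simp only [hφ, hl0, hk ζ hζ]
  have hφd : HasDerivAt φ ((deriv ψ ζ)⁻¹ * (ψ ξ - ψ ζ)) 0 := by
    have hl : HasDerivAt (fun t : ℝ => ψ ζ + t * (ψ ξ - ψ ζ)) (ψ ξ - ψ ζ) 0 := by
      have := ((Complex.ofRealCLM.hasDerivAt (x := (0 : ℝ))).mul_const (ψ ξ - ψ ζ)).const_add (ψ ζ)
      simpa using! this
    have hk1 : HasDerivAt k (deriv ψ ζ)⁻¹ (ψ ζ + ((0 : ℝ) : ℂ) * (ψ ξ - ψ ζ)) := by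
      rw [hl0]; exact hkd ζ hζ
    exact HasDerivAt.comp (h₂ := k) (0 : ℝ) hk1 hl
  have hneg := hφd.normSq.nonpos_of_eventually_le (by
    filter_upwards [Ioo_mem_nhdsGT (zero_lt_one' ℝ)] with t ht
    have h1 := hle t (Ioo_subset_Icc_self ht)
    have h2 : (1 - t : ℝ) • ψ ζ + t • ψ (x * ζ) = ψ ζ + t * (ψ ξ - ψ ζ) := by
      rw [hxζ]; simp; ring
    rw [h2] at h1
    rw [hφ0, Complex.normSq_eq_norm_sq, Complex.normSq_eq_norm_sq]
    exact pow_le_pow_left₀ (norm_nonneg _) h1 2)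
  rw [hφ0] at hneg
  rcases eq_or_ne (ψ ζ) (ψ ξ) with he | hne
  · simp [he]
  have hne' := sub_ne_zero.2 hne
  have e : ζ * deriv ψ ζ / (ψ ζ - ψ ξ) = (Complex.normSq (deriv ψ ζ / (ψ ζ - ψ ξ)) : ℂ) *
      (starRingEnd ℂ) (-((deriv ψ ζ)⁻¹ * (ψ ξ - ψ ζ) * (starRingEnd ℂ) ζ)) := by
    rw [Complex.normSq_eq_conj_mul_self]
    have c1 : (starRingEnd ℂ) (deriv ψ ζ) ≠ 0 := by simpa using hd0
    have c2 : (starRingEnd ℂ) (ψ ζ) - (starRingEnd ℂ) (ψ ξ) ≠ 0 := by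
      rw [← map_sub]; exact (map_ne_zero _).2 hne'
    simp only [map_neg, map_mul, map_div₀, map_inv₀, map_sub, Complex.conj_conj]
    field_simp
    ring
  rw [e, Complex.re_ofReal_mul, Complex.conj_re, Complex.neg_re]
  exact mul_nonneg (Complex.normSq_nonneg _) (by linarith)

/-- Minimum principle for `Re H`, from the maximum principle for `exp (-H)`. -/
theorem re_pos_of_re_nonneg {H : ℂ → ℂ} {V : Set ℂ} (hV : IsOpen V) (hVc : IsPreconnected V)
    (hH : DifferentiableOn ℂ H V) (h0 : ∀ x ∈ V, 0 ≤ (H x).re) {x₀ : ℂ} (hx₀ : x₀ ∈ V)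
    (h1 : 0 < (H x₀).re) {x : ℂ} (hx : x ∈ V) : 0 < (H x).re := by
  refine (h0 x hx).lt_of_ne fun he => ?_
  have hE := Complex.norm_eqOn_of_isPreconnected_of_isMaxOn (f := fun z => Complex.exp (-H z))
    hVc hV hH.neg.cexp hx (by
      intro y hy
      simp only [Function.comp, Complex.norm_exp, Complex.neg_re, ← he, mem_ofPred_eq]
      simpa using h0 y hy) hx₀
  simp only [Function.comp, Complex.norm_exp, Complex.neg_re, Function.const, ← he] at hE
  have := Real.exp_injective hE
  linarith

/-- Convex functions are starlike with respect to the centre. -/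
theorem ConvexUnivalent.re_mul_deriv_div_sub_zero_pos {ψ : ℂ → ℂ} (hψ : ConvexUnivalent ψ)
    {ζ : ℂ} (hζ : ζ ∈ U) (hζ0 : ζ ≠ 0) : 0 < (ζ * deriv ψ ζ / (ψ ζ - ψ 0)).re := by
  have hd0 : ∀ z ∈ U, deriv ψ z ≠ 0 := fun z hz =>
    deriv_ne_zero_of_injOn isOpen_U hψ.1.1 hψ.1.2 hz
  have hD : ∀ z ∈ U, dslope ψ 0 z ≠ 0 := by
    intro z hz
    rcases eq_or_ne z 0 with rfl | hz0
    · rw [dslope_same]; exact hd0 0 hz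
    · rw [dslope_of_ne _ hz0, slope_def_field]
      exact div_ne_zero (sub_ne_zero.2 fun h => hz0 (hψ.1.2 hz zero_mem_U h)) (by simpa using hz0)
  have hE : ∀ z, z ≠ 0 → deriv ψ z / dslope ψ 0 z = z * deriv ψ z / (ψ z - ψ 0) := by
    intro z hz0
    rw [dslope_of_ne _ hz0, slope_def_field, sub_zero, div_div_eq_mul_div, mul_comm]
  rw [← hE ζ hζ0]
  refine re_pos_of_re_nonneg isOpen_U isPreconnected_U (H := fun z => deriv ψ z / dslope ψ 0 z)
    ?_ ?_ zero_mem_U ?_ hζ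
  · exact (hψ.1.1.deriv isOpen_U).div
      ((Complex.differentiableOn_dslope (isOpen_U.mem_nhds zero_mem_U)).2 hψ.1.1) hD
  · intro z hz
    rcases eq_or_ne z 0 with rfl | hz0
    · simp [dslope_same, hd0 0 hz]
    · simp only [hE z hz0]
      exact hψ.re_mul_deriv_div_sub_nonneg hz (by simp)
  · simp [dslope_same, hd0 0 zero_mem_U]

/-- For a convex function `ψ` and `‖x‖ < 1`, the function `z ↦ ψ z - ψ (x * z)` is starlike. The
quotient is analytic in `x = ξ / ζ`, also at `x = 1` where its singularity is removable. On the
circle `‖x‖ = 1` it is the sum of two terms as in `re_mul_deriv_div_sub_nonneg`. -/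
theorem ConvexUnivalent.re_sub_div_sub_pos {ψ : ℂ → ℂ} (hψ : ConvexUnivalent ψ)
    {ζ ξ : ℂ} (hζ : ζ ∈ U) (hξ : ‖ξ‖ < ‖ζ‖) :
    0 < ((ζ * deriv ψ ζ - ξ * deriv ψ ξ) / (ψ ζ - ψ ξ)).re := by
  have hζ0 : ζ ≠ 0 := by
    rintro rfl
    simp at hξ
    exact absurd hξ (not_lt.2 (norm_nonneg _))
  have hζn : 0 < ‖ζ‖ := norm_pos_iff.2 hζ0
  set V : Set ℂ := Metric.ball 0 (1 / ‖ζ‖) with hV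
  have hVo : IsOpen V := Metric.isOpen_ball
  have hVU : ∀ x ∈ V, x * ζ ∈ U := by
    intro x hx
    rw [hV, mem_ball_zero_iff, lt_div_iff₀ hζn] at hx
    rwa [mem_U_iff, norm_mul]
  have hsub : Metric.closedBall (0 : ℂ) 1 ⊆ V := by
    refine Metric.closedBall_subset_ball ?_
    rw [lt_div_iff₀ hζn, one_mul]
    exact mem_U_iff.1 hζ
  have h1V : (1 : ℂ) ∈ V := hsub (by simp)
  set N : ℂ → ℂ := fun x => x * ζ * deriv ψ (x * ζ) with hN
  set D : ℂ → ℂ := fun x => ψ (x * ζ) with hD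
  have hmul : DifferentiableOn ℂ (fun x : ℂ => x * ζ) V := by fun_prop
  have hNd : DifferentiableOn ℂ N V :=
    hmul.mul ((hψ.1.1.deriv isOpen_U).comp hmul hVU)
  have hDd : DifferentiableOn ℂ D V := hψ.1.1.comp hmul hVU
  have hDinj : InjOn D V := fun x hx y hy hxy =>
    mul_right_cancel₀ hζ0 (hψ.1.2 (hVU x hx) (hVU y hy) hxy)
  have hDs : ∀ x ∈ V, dslope D 1 x ≠ 0 := by
    intro x hx
    rcases eq_or_ne x 1 with rfl | hx1
    · rw [dslope_same]
      exact deriv_ne_zero_of_injOn hVo hDd hDinj hx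
    · rw [dslope_of_ne _ hx1, slope_def_field]
      exact div_ne_zero (sub_ne_zero.2 fun h => hx1 (hDinj hx h1V h)) (sub_ne_zero.2 hx1)
  -- the quotient of the statement as a function of `x`, with its singularity at `1` removed
  set H : ℂ → ℂ := fun x => dslope N 1 x / dslope D 1 x with hH
  have hHd : DifferentiableOn ℂ H V :=
    ((Complex.differentiableOn_dslope (hVo.mem_nhds h1V)).2 hNd).div
      ((Complex.differentiableOn_dslope (hVo.mem_nhds h1V)).2 hDd) hDs
  have hHe : ∀ x, x ≠ 1 → H x =
      (ζ * deriv ψ ζ - x * ζ * deriv ψ (x * ζ)) / (ψ ζ - ψ (x * ζ)) := by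
    intro x hx1
    simp only [hH]
    rw [dslope_of_ne _ hx1, dslope_of_ne _ hx1, slope_def_field, slope_def_field,
      div_div_div_cancel_right₀ (sub_ne_zero.2 hx1), ← neg_div_neg_eq]
    simp only [hN, hD, neg_sub, one_mul]
  have hcirc : ∀ x, ‖x‖ = 1 → x ≠ 1 → 0 ≤ (H x).re := by
    intro x hx hx1
    have hxζ : ‖x * ζ‖ = ‖ζ‖ := by rw [norm_mul, hx, one_mul]
    have e : H x = ζ * deriv ψ ζ / (ψ ζ - ψ (x * ζ)) +
        x * ζ * deriv ψ (x * ζ) / (ψ (x * ζ) - ψ ζ) := by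
      rw [hHe x hx1, ← neg_sub (ψ ζ) (ψ (x * ζ)), div_neg, ← sub_eq_add_neg, ← sub_div]
    rw [e, Complex.add_re]
    exact add_nonneg (hψ.re_mul_deriv_div_sub_nonneg hζ hxζ.le)
      (hψ.re_mul_deriv_div_sub_nonneg (hVU x (hsub (by simp [hx]))) hxζ.ge)
  have hcirc' : ∀ x, ‖x‖ = 1 → 0 ≤ (H x).re := by
    intro x hx
    rcases eq_or_ne x 1 with rfl | hx1
    · have hc : Tendsto (fun θ : ℝ => (H (Complex.exp (θ * Complex.I))).re) (𝓝[>] 0)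
          (𝓝 (H 1).re) := by
        have h1 : ContinuousAt H (Complex.exp (((0 : ℝ) : ℂ) * Complex.I)) := by
          simpa using (hHd.differentiableAt (hVo.mem_nhds h1V)).continuousAt
        have h2 : ContinuousAt (fun θ : ℝ => Complex.exp (θ * Complex.I)) 0 := by fun_prop
        have h3 : ContinuousAt (fun θ : ℝ => H (Complex.exp (θ * Complex.I))) 0 :=
          ContinuousAt.comp (g := H) h1 h2
        have h4 := (Complex.continuous_re.continuousAt.comp h3).tendsto.mono_left
          (nhdsWithin_le_nhds (s := Ioi 0))
        simpa using! h4
      refine ge_of_tendsto hc ?_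
      filter_upwards [Ioo_mem_nhdsGT Real.pi_pos] with θ hθ
      refine hcirc _ (Complex.norm_exp_ofReal_mul_I θ) fun h => ?_
      have := congrArg Complex.im h
      rw [Complex.exp_ofReal_mul_I_im, Complex.one_im] at this
      exact (Real.sin_pos_of_pos_of_lt_pi hθ.1 hθ.2).ne' this
    · exact hcirc x hx hx1
  have hball : ∀ x ∈ Metric.ball (0 : ℂ) 1, 0 ≤ (H x).re := by
    intro x hx
    have hdc : DiffContOnCl ℂ (fun z => Complex.exp (-H z)) (Metric.ball 0 1) := by
      have h2 : DifferentiableOn ℂ (fun z => Complex.exp (-H z)) V := hHd.neg.cexp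
      refine ⟨h2.mono (Metric.ball_subset_closedBall.trans hsub), ?_⟩
      exact h2.continuousOn.mono (Metric.closure_ball_subset_closedBall.trans hsub)
    have := Complex.norm_le_of_forall_mem_frontier_norm_le Metric.isBounded_ball hdc (C := 1)
      (fun z hz => by
        rw [frontier_ball _ one_ne_zero, mem_sphere_zero_iff_norm] at hz
        rw [Complex.norm_exp, Real.exp_le_one_iff, Complex.neg_re]
        linarith [hcirc' z hz]) (subset_closure hx)
    rw [Complex.norm_exp, Real.exp_le_one_iff, Complex.neg_re] at this
    linarith
  have hne1 : ξ / ζ ≠ 1 := fun h => by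
    rw [(div_eq_one_iff_eq hζ0).1 h] at hξ
    exact lt_irrefl _ hξ
  have hfin := re_pos_of_re_nonneg Metric.isOpen_ball (convex_ball (0 : ℂ) 1).isPreconnected
    (hHd.mono (Metric.ball_subset_closedBall.trans hsub)) hball
    (x₀ := 0) (Metric.mem_ball_self one_pos) (by
      rw [hHe 0 zero_ne_one]
      simpa using hψ.re_mul_deriv_div_sub_zero_pos hζ hζ0)
    (x := ξ / ζ) (by
      rw [mem_ball_zero_iff, norm_div]
      exact (div_lt_one hζn).2 hξ)
  rwa [hHe _ hne1, div_mul_cancel₀ _ hζ0] at hfin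

/-- The functions `γ * ψ z + s * z * ψ' z`, for increasing `s`, form a subordination chain: a value
taken at `ξ` for a parameter `t ≤ s` is not taken for `s` at a point of larger modulus. -/
theorem ConvexUnivalent.chain_ne {ψ : ℂ → ℂ} (hψ : ConvexUnivalent ψ) {γ : ℂ} (hγ : 0 ≤ γ.re)
    {t s : ℝ} (ht : 0 < t) (hts : t ≤ s) {ζ ξ : ℂ} (hζ : ζ ∈ U) (hξ : ‖ξ‖ < ‖ζ‖) :
    γ * ψ ζ + s * (ζ * deriv ψ ζ) ≠ γ * ψ ξ + t * (ξ * deriv ψ ξ) := by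
  intro h
  have hξU : ξ ∈ U := mem_U_iff.2 (hξ.trans (mem_U_iff.1 hζ))
  have hne : ψ ζ - ψ ξ ≠ 0 := sub_ne_zero.2 fun h => by
    rw [hψ.1.2 hζ hξU h] at hξ
    exact lt_irrefl _ hξ
  have h1 := hψ.re_mul_deriv_div_sub_nonneg hζ hξ.le
  have h2 := hψ.re_sub_div_sub_pos hζ hξ
  have e : γ + t * ((ζ * deriv ψ ζ - ξ * deriv ψ ξ) / (ψ ζ - ψ ξ)) +
      ((s - t : ℝ) : ℂ) * (ζ * deriv ψ ζ / (ψ ζ - ψ ξ)) = 0 := by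
    field_simp
    push_cast
    linear_combination h
  have e' := congrArg Complex.re e
  rw [Complex.add_re, Complex.add_re, Complex.re_ofReal_mul, Complex.re_ofReal_mul,
    Complex.zero_re] at e'
  have := mul_pos ht h2
  have := mul_nonneg (sub_nonneg.2 hts) h1
  linarith

/-- Each value of a chain member with parameter `t ≤ 1` is a value of the member with parameter `1`.
By `chain_ne`, the solutions of the equation for the intermediate parameters stay
in a fixed disk compactly contained in `U`, and by the open mapping theorem they persist. -/
theorem ConvexUnivalent.exists_chain_eq {ψ : ℂ → ℂ} (hψ : ConvexUnivalent ψ) {γ : ℂ}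
    (hγ : 0 ≤ γ.re) {t : ℝ} (ht : 0 < t) (ht1 : t ≤ 1) {z₀ : ℂ} (hz₀ : z₀ ∈ U) :
    ∃ ξ ∈ U, γ * ψ ξ + ξ * deriv ψ ξ = γ * ψ z₀ + t * (z₀ * deriv ψ z₀) := by
  set c := γ * ψ z₀ + t * (z₀ * deriv ψ z₀) with hc
  obtain ⟨r, hr, hr1⟩ := exists_between (mem_U_iff.1 hz₀)
  have hsub : Metric.closedBall (0 : ℂ) r ⊆ U := Metric.closedBall_subset_ball hr1
  set F : ℝ → ℂ → ℂ := fun s z => γ * ψ z + s * (z * deriv ψ z) with hF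
  have hgd : DifferentiableOn ℂ (fun z => z * deriv ψ z) U :=
    differentiableOn_id.mul (hψ.1.1.deriv isOpen_U)
  have hFd : ∀ s, DifferentiableOn ℂ (F s) U := fun s =>
    (hψ.1.1.const_mul γ).add (hgd.const_mul (s : ℂ))
  have hFne : ∀ s, t ≤ s → ∀ z ∈ U, ‖z₀‖ < ‖z‖ → F s z ≠ c := fun s hs z hz hlt =>
    hψ.chain_ne hγ ht hs hz hlt
  set S : Set ℝ := {s | ∃ z ∈ Metric.closedBall (0 : ℂ) r, F s z = c} with hS
  have hK : IsCompact (Metric.closedBall (0 : ℂ) r) := isCompact_closedBall 0 r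
  have hclosed : IsClosed (S ∩ Icc t 1) := by
    have hcont : ContinuousOn (fun p : ℝ × ℂ => F p.1 p.2)
        (Icc t 1 ×ˢ Metric.closedBall (0 : ℂ) r) := by
      have h2 : MapsTo Prod.snd (Icc t 1 ×ˢ Metric.closedBall (0 : ℂ) r) U :=
        fun p hp => hsub hp.2
      exact (continuousOn_const.mul (hψ.1.1.continuousOn.comp continuousOn_snd h2)).add
        ((Complex.continuous_ofReal.comp_continuousOn continuousOn_fst).mul
          (hgd.continuousOn.comp continuousOn_snd h2))
    have hcomp : IsCompact ((Icc t 1 ×ˢ Metric.closedBall (0 : ℂ) r) ∩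
        (fun p : ℝ × ℂ => F p.1 p.2) ⁻¹' {c}) :=
      (isCompact_Icc.prod hK).of_isClosed_subset
        (hcont.preimage_isClosed_of_isClosed (isClosed_Icc.prod Metric.isClosed_closedBall)
          isClosed_singleton) inter_subset_left
    have he : S ∩ Icc t 1 = Prod.fst '' ((Icc t 1 ×ˢ Metric.closedBall (0 : ℂ) r) ∩
        (fun p : ℝ × ℂ => F p.1 p.2) ⁻¹' {c}) := by
      ext s
      constructor
      · rintro ⟨⟨z, hz, hzc⟩, hs⟩
        exact ⟨(s, z), ⟨⟨hs, hz⟩, hzc⟩, rfl⟩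
      · rintro ⟨⟨s', z⟩, ⟨⟨hs, hz⟩, hzc⟩, rfl⟩
        exact ⟨⟨z, hz, hzc⟩, hs⟩
    rw [he]
    exact (hcomp.image continuous_fst).isClosed
  have htS : t ∈ S := ⟨z₀, by simpa using hr.le, rfl⟩
  obtain ⟨M, hM⟩ := hK.exists_bound_of_continuousOn (hgd.continuousOn.mono hsub)
  have h1S : (1 : ℝ) ∈ S := by
    refine hclosed.mem_of_ge_of_forall_exists_gt htS ht1 ?_
    rintro s ⟨⟨z, hz, hzc⟩, hts, hs1⟩
    have hzr : ‖z‖ < r := by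
      by_contra hn
      exact hFne s hts z (hsub hz) (hr.trans_le (not_lt.1 hn)) hzc
    have hM0 : 0 ≤ M := (norm_nonneg _).trans (hM z hz)
    have hFa : AnalyticAt ℂ (F s) z := (hFd s).analyticAt (isOpen_U.mem_nhds (hsub hz))
    have hnc : ∀ᶠ w in 𝓝[≠] z, F s w ≠ c := by
      refine (hFa.eventually_eq_or_eventually_ne analyticAt_const).resolve_left fun hev => ?_
      have := ((hFd s).analyticOnNhd isOpen_U).eqOn_of_preconnected_of_eventuallyEq
        analyticOnNhd_const isPreconnected_U (hsub hz) hev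
      have hrU : (r : ℂ) ∈ U := hsub (by
        simp [abs_of_nonneg ((norm_nonneg _).trans hr.le)])
      refine hFne s hts r hrU ?_ (this hrU)
      rw [Complex.norm_real, Real.norm_eq_abs]
      exact hr.trans_le (le_abs_self r)
    have hzball : ∀ᶠ w in 𝓝 z, w ∈ Metric.ball (0 : ℂ) r :=
      Metric.isOpen_ball.mem_nhds (by simpa using hzr)
    obtain ⟨ρ, hρ, hρs⟩ := Metric.nhds_basis_closedBall.mem_iff.1
      (hzball.and (eventually_nhdsWithin_iff.1 hnc))
    have hρr : Metric.closedBall z ρ ⊆ Metric.closedBall 0 r := fun w hw =>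
      Metric.ball_subset_closedBall (hρs hw).1
    have hcs : ContinuousOn (fun w => ‖F s w - c‖) (Metric.sphere z ρ) :=
      (((hFd s).continuousOn.mono ((Metric.sphere_subset_closedBall.trans hρr).trans hsub)).sub
        continuousOn_const).norm
    obtain ⟨w₀, hw₀, hmin⟩ := (isCompact_sphere z ρ).exists_isMinOn
      (NormedSpace.sphere_nonempty.2 hρ.le) hcs
    -- on the circle `F s` stays at distance `ε` from `c`; a step `δ` moves `F` by at most `ε / 8`
    set ε := ‖F s w₀ - c‖ with hε
    have hε0 : 0 < ε := norm_pos_iff.2 <| sub_ne_zero.2 <|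
      (hρs (Metric.sphere_subset_closedBall hw₀)).2 (Metric.ne_of_mem_sphere hw₀ hρ.ne')
    set δ := min (1 - s) (ε / (8 * (M + 1))) with hδ
    have hδ0 : 0 < δ := lt_min (by linarith) (by positivity)
    have hδM : δ * M ≤ ε / 8 := by
      have : δ * (8 * (M + 1)) ≤ ε := (le_div_iff₀ (by positivity)).1 (min_le_right _ _)
      nlinarith
    have hdiff : ∀ w ∈ Metric.closedBall (0 : ℂ) r, ‖F (s + δ) w - F s w‖ ≤ ε / 8 := by
      intro w hw
      have : F (s + δ) w - F s w = δ * (w * deriv ψ w) := by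
        simp only [hF]; push_cast; ring
      rw [this, norm_mul, Complex.norm_real, Real.norm_eq_abs, abs_of_pos hδ0]
      exact (mul_le_mul_of_nonneg_left (hM w hw) hδ0.le).trans hδM
    refine ⟨s + δ, ?_, by linarith, by linarith [min_le_left (1 - s) (ε / (8 * (M + 1)))]⟩
    have hsph : ∀ w ∈ Metric.sphere z ρ, ε / 2 ≤ ‖F (s + δ) w - F (s + δ) z‖ := by
      intro w hw
      have a1 := hdiff w (hρr (Metric.sphere_subset_closedBall hw))
      have a2 := hdiff z hz
      have a3 : ε ≤ ‖F s w - c‖ := hmin hw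
      have a4 : F s w - c = (F (s + δ) w - F (s + δ) z) - (F (s + δ) w - F s w) +
          (F (s + δ) z - F s z) := by rw [hzc]; ring
      have a5 := norm_add_le ((F (s + δ) w - F (s + δ) z) - (F (s + δ) w - F s w))
        (F (s + δ) z - F s z)
      have a6 := norm_sub_le (F (s + δ) w - F (s + δ) z) (F (s + δ) w - F s w)
      rw [← a4] at a5
      linarith
    have hnc' : ∃ᶠ w in 𝓝 z, F (s + δ) w ≠ F (s + δ) z := by
      intro hev
      have := ((hFd (s + δ)).analyticOnNhd isOpen_U).eqOn_of_preconnected_of_eventuallyEq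
        analyticOnNhd_const isPreconnected_U (hsub hz)
        (hev.mono fun w hw => not_not.1 hw)
      have h2 := hsph w₀ hw₀
      rw [show F (s + δ) w₀ = F (s + δ) z from
        this (hsub (hρr (Metric.sphere_subset_closedBall hw₀))), sub_self, norm_zero] at h2
      linarith
    have hdc : DiffContOnCl ℂ (F (s + δ)) (Metric.ball z ρ) :=
      ⟨(hFd _).mono ((Metric.ball_subset_closedBall.trans hρr).trans hsub),
        (hFd _).continuousOn.mono ((Metric.closure_ball_subset_closedBall.trans hρr).trans hsub)⟩
    obtain ⟨w, hw, hwc⟩ := hdc.ball_subset_image_closedBall hρ hsph hnc' (show c ∈ _ by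
      rw [mem_ball_iff_norm, ← hzc, norm_sub_rev]
      linarith [hdiff z hz])
    exact ⟨w, hρr hw, hwc⟩
  obtain ⟨ξ, hξ, hξc⟩ := h1S
  refine ⟨ξ, hsub hξ, ?_⟩
  simpa [hF] using hξc

/-! ### Subordination and the first contact with the boundary -/

/-- By the Schwarz lemma, subordination to a univalent function means inclusion of the images. -/
theorem Univalent.subordinate_of_mapsTo_image {q ψ : ℂ → ℂ} (hψ : Univalent ψ)
    (hq : DifferentiableOn ℂ q U) (h0 : q 0 = ψ 0) (h : MapsTo q U (ψ '' U)) :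
    Subordinate q ψ := by
  obtain ⟨k, hk, hkd⟩ := exists_hasDerivAt_leftInverse_of_injOn isOpen_U hψ.1 hψ.2
  have hd : DifferentiableOn ℂ (fun z => k (q z)) U := by
    intro z hz
    obtain ⟨y, hy, hyz⟩ := h hz
    have h1 := (hkd y hy).differentiableAt
    rw [hyz] at h1
    exact (h1.comp z (hq.differentiableAt (isOpen_U.mem_nhds hz))).differentiableWithinAt
  refine ⟨fun z => k (q z), hd, fun z hz => ?_, fun z hz => ?_⟩
  · refine Complex.norm_le_norm_of_mapsTo_ball (R := 1) hd (fun x hx => ?_) ?_ (mem_U_iff.1 hz)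
    · obtain ⟨y, hy, hyx⟩ := h hx
      simp only [← hyx, hk y hy]
      exact Metric.ball_subset_closedBall hy
    · simp only [h0]
      exact hk 0 zero_mem_U
  · obtain ⟨y, hy, hyz⟩ := h hz
    simp only [← hyz, hk y hy]

/-- A function which leaves the open set `V` does so first at some point `z₀`. -/
theorem exists_first_exit {f : ℂ → ℂ} {V : Set ℂ} (hV : IsOpen V) (hf : ContinuousOn f U)
    (h0 : f 0 ∈ V) {z₁ : ℂ} (hz₁ : z₁ ∈ U) (h1 : f z₁ ∉ V) :
    ∃ z₀ : ℂ, z₀ ≠ 0 ∧ ‖z₀‖ ≤ ‖z₁‖ ∧ f z₀ ∉ V ∧ f z₀ ∈ closure V ∧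
      ∀ z, ‖z‖ < ‖z₀‖ → f z ∈ V := by
  have hsub : Metric.closedBall (0 : ℂ) ‖z₁‖ ⊆ U :=
    Metric.closedBall_subset_ball (mem_U_iff.1 hz₁)
  have hK : IsCompact (Metric.closedBall (0 : ℂ) ‖z₁‖ ∩ f ⁻¹' Vᶜ) :=
    (isCompact_closedBall 0 ‖z₁‖).of_isClosed_subset
      ((hf.mono hsub).preimage_isClosed_of_isClosed Metric.isClosed_closedBall hV.isClosed_compl)
      inter_subset_left
  obtain ⟨z₀, ⟨hz₀, hz₀V⟩, hmin⟩ := hK.exists_isMinOn ⟨z₁, by simp, h1⟩ continuous_norm.continuousOn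
  rw [mem_closedBall_zero_iff] at hz₀
  have hz00 : z₀ ≠ 0 := by
    rintro rfl
    exact hz₀V h0
  have hin : ∀ z, ‖z‖ < ‖z₀‖ → f z ∈ V := by
    intro z hz
    by_contra hzV
    exact (hz.trans_le (hmin ⟨by simpa using hz.le.trans hz₀, hzV⟩)).false
  refine ⟨z₀, hz00, hz₀, hz₀V, ?_, hin⟩
  have hc : ContinuousWithinAt f (Metric.ball 0 ‖z₀‖) z₀ :=
    (hf.continuousAt (isOpen_U.mem_nhds (hsub (by simpa using hz₀)))).continuousWithinAt
  refine hc.mem_closure ?_ fun z hz => hin z (by simpa using hz)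
  rw [closure_ball _ (norm_pos_iff.2 hz00).ne']
  simp

/-- Subordination of `γ * q + z * q'` to `γ * ψ + z * ψ'` implies subordination of `q` to `ψ`. At a
first exit point `z₀` of `q` from `ψ (|z| < r)`, Jack's lemma turns `γ * q + z * q'` into a later
chain member at a point of modulus `r > |z₀|`, against `ConvexUnivalent.chain_ne`. -/
theorem ConvexUnivalent.subordinate_of_deriv {ψ q : ℂ → ℂ} (hψ : ConvexUnivalent ψ) {γ : ℂ}
    (hγ : 0 ≤ γ.re) (hq : DifferentiableOn ℂ q U) (h0 : q 0 = ψ 0)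
    (h : ∀ z ∈ U, ∃ ξ : ℂ, ‖ξ‖ ≤ ‖z‖ ∧
      γ * q z + z * deriv q z = γ * ψ ξ + ξ * deriv ψ ξ) :
    Subordinate q ψ := by
  refine hψ.1.subordinate_of_mapsTo_image hq h0 fun z₁ hz₁ => ?_
  obtain ⟨r, hr, hr1⟩ := exists_between (mem_U_iff.1 hz₁)
  have hr0 : 0 < r := (norm_nonneg _).trans_lt hr
  have hbU : Metric.ball (0 : ℂ) r ⊆ U := Metric.ball_subset_ball hr1.le
  have hcU : Metric.closedBall (0 : ℂ) r ⊆ U := Metric.closedBall_subset_ball hr1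
  by_contra hz₁V
  obtain ⟨z₀, hz00, hz₀z₁, hz₀V, hz₀c, hin⟩ := exists_first_exit
    (isOpen_image_of_injOn Metric.isOpen_ball (hψ.1.1.mono hbU) (hψ.1.2.mono hbU))
    hq.continuousOn (h0 ▸ mem_image_of_mem ψ (Metric.mem_ball_self hr0)) hz₁
    (fun hmem => hz₁V (image_mono hbU hmem))
  have hz₀U : z₀ ∈ U := mem_U_iff.2 (hz₀z₁.trans_lt (mem_U_iff.1 hz₁))
  obtain ⟨ζ, hζ, hζq⟩ : q z₀ ∈ ψ '' Metric.closedBall 0 r := by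
    refine closure_minimal (image_mono Metric.ball_subset_closedBall) ?_ hz₀c
    exact ((isCompact_closedBall (0 : ℂ) r).image_of_continuousOn
      (hψ.1.1.continuousOn.mono hcU)).isClosed
  have hζr : ‖ζ‖ = r := by
    refine le_antisymm (by simpa using hζ) (not_lt.1 fun hlt => hz₀V ?_)
    exact ⟨ζ, by simpa using hlt, hζq⟩
  obtain ⟨k, hk, hkd⟩ := exists_hasDerivAt_leftInverse_of_injOn isOpen_U hψ.1.1 hψ.1.2
  set w : ℂ → ℂ := fun z => k (q z) with hw
  have hw0 : w z₀ = ζ := by simp only [hw, ← hζq, hk ζ (hcU hζ)]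
  have hq0 := (hq.differentiableAt (isOpen_U.mem_nhds hz₀U)).hasDerivAt
  have hwd : HasDerivAt w ((deriv ψ ζ)⁻¹ * deriv q z₀) z₀ := by
    have h1 := hkd ζ (hcU hζ)
    rw [hζq] at h1
    exact h1.comp z₀ hq0
  have hwball : ∀ z ∈ Metric.ball (0 : ℂ) ‖z₀‖, DifferentiableAt ℂ w z ∧
      w z ∈ Metric.closedBall 0 r := by
    intro z hz
    obtain ⟨y, hy, hyz⟩ := hin z (by simpa using hz)
    have h1 := (hkd y (hbU hy)).differentiableAt
    rw [hyz] at h1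
    have hzU : z ∈ U := mem_U_iff.2
      ((show ‖z‖ < ‖z₀‖ by simpa using hz).trans (mem_U_iff.1 hz₀U))
    refine ⟨h1.comp z (hq.differentiableAt (isOpen_U.mem_nhds hzU)), ?_⟩
    simp only [hw, ← hyz, hk y (hbU hy)]
    exact Metric.ball_subset_closedBall hy
  have hw00 : w 0 = 0 := by simp only [hw, h0, hk 0 zero_mem_U]
  have hζ0 : ζ ≠ 0 := norm_pos_iff.1 (hζr ▸ hr0)
  obtain ⟨m, hm, hmw⟩ := exists_one_le_mul_deriv_eq hz00 hwd.differentiableAt (hw0 ▸ hζ0) (by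
    refine Eventually.of_forall fun z hz => ?_
    have := Complex.dist_le_div_mul_dist_of_mapsTo_ball (f := w) (R₂ := r)
      (fun x hx => (hwball x hx).1.differentiableWithinAt)
      (fun x hx => by rw [hw00]; exact (hwball x hx).2)
      (show z ∈ Metric.ball (0 : ℂ) ‖z₀‖ by simpa using hz)
    rw [hw00, dist_zero_right, dist_zero_right, div_mul_eq_mul_div,
      le_div_iff₀ (norm_pos_iff.2 hz00)] at this
    rwa [hw0, hζr])
  have hd0 := deriv_ne_zero_of_injOn isOpen_U hψ.1.1 hψ.1.2 (hcU hζ)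
  rw [hwd.deriv, hw0] at hmw
  have hzq : z₀ * deriv q z₀ = m * (ζ * deriv ψ ζ) := by
    field_simp at hmw
    linear_combination hmw
  obtain ⟨ξ, hξ, hξe⟩ := h z₀ hz₀U
  refine hψ.chain_ne hγ one_pos hm (hcU hζ) (ξ := ξ) ?_ ?_
  · rw [hζr]
    exact hξ.trans_lt (hz₀z₁.trans_lt hr)
  · rw [hζq, ← hzq, hξe]
    simp

/-! ### Boundary values of functions of class `𝒬` -/

theorem U_subset_closedBall_diff (q : ℂ → ℂ) :
    U ⊆ Metric.closedBall (0 : ℂ) 1 \ exceptionalSet q := by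
  refine fun z hz => ⟨Metric.ball_subset_closedBall hz, fun hE => ?_⟩
  have h1 := mem_U_iff.1 hz
  rw [mem_sphere_zero_iff_norm.1 hE.1] at h1
  exact lt_irrefl _ h1

/-- If `q` has a finite limit outside its image along `w`, then `w` runs into a boundary point at
which `q` extends. -/
theorem mem_sphere_diff_of_tendsto {q g : ℂ → ℂ} (hgq : EqOn g q U)
    (hg : AnalyticOnNhd ℂ g (Metric.closedBall (0 : ℂ) 1 \ exceptionalSet q))
    {ι : Type*} {l : Filter ι} [l.NeBot] {w : ι → ℂ} {ζ c : ℂ} (hw : ∀ᶠ i in l, w i ∈ U)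
    (hwζ : Tendsto w l (𝓝 ζ)) (hqw : Tendsto (fun i => q (w i)) l (𝓝 c)) (hc : c ∉ q '' U) :
    ζ ∈ Metric.sphere (0 : ℂ) 1 \ exceptionalSet q ∧ g ζ = c := by
  have hζb : ζ ∈ Metric.closedBall (0 : ℂ) 1 :=
    Metric.isClosed_closedBall.mem_of_tendsto hwζ
      (hw.mono fun i hi => Metric.ball_subset_closedBall hi)
  have hζE : ζ ∉ exceptionalSet q := by
    intro hE
    have h1 : Tendsto w l (𝓝[U] ζ) := tendsto_nhdsWithin_iff.2 ⟨hwζ, hw⟩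
    exact (hE.2.comp h1).not_tendsto (Metric.disjoint_nhds_cobounded c).symm hqw
  have hgc : g ζ = c := by
    have h1 : Tendsto (fun i => g (w i)) l (𝓝 (g ζ)) :=
      (hg ζ ⟨hζb, hζE⟩).continuousAt.tendsto.comp hwζ
    refine tendsto_nhds_unique (h1.congr' ?_) hqw
    filter_upwards [hw] with i hi
    exact hgq hi
  refine ⟨⟨?_, hζE⟩, hgc⟩
  rw [mem_sphere_zero_iff_norm]
  refine le_antisymm (by simpa using hζb) (not_lt.1 fun hlt => hc ?_)
  exact ⟨ζ, mem_U_iff.2 hlt, by rw [← hgq (mem_U_iff.2 hlt), hgc]⟩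

/-- By the open mapping theorem, a boundary value of a univalent function is not a value. -/
theorem Univalent.ne_of_tendsto {F : ℂ → ℂ} (hF : Univalent F) {ζ c : ℂ}
    (hζ : ζ ∈ Metric.sphere (0 : ℂ) 1) (hc : Tendsto F (𝓝[U] ζ) (𝓝 c)) {y : ℂ} (hy : y ∈ U) :
    F y ≠ c := by
  rintro rfl
  have hyζ : y ≠ ζ := by
    rintro rfl
    exact (mem_U_iff.1 hy).ne (mem_sphere_zero_iff_norm.1 hζ)
  obtain ⟨A, B, hA, hB, hyA, hζB, hAB⟩ := t2_separation hyζ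
  have hI : F '' (A ∩ U) ∈ 𝓝 (F y) := nhds_le_map_of_injOn isOpen_U hF.1 hF.2 hy
    (image_mem_map (inter_mem (hA.mem_nhds hyA) (isOpen_U.mem_nhds hy)))
  have hne : (𝓝[U] ζ).NeBot := by
    rw [← mem_closure_iff_nhdsWithin_neBot, U, closure_ball _ one_ne_zero]
    exact Metric.sphere_subset_closedBall hζ
  obtain ⟨x, ⟨⟨x', ⟨hx'A, hx'U⟩, hx'⟩, hxU⟩, hxB⟩ := ((hc.eventually_mem hI).and
    self_mem_nhdsWithin |>.and (mem_nhdsWithin_of_mem_nhds (hB.mem_nhds hζB))).exists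
  rw [hF.2 hx'U hxU hx'] at hx'A
  exact disjoint_left.1 hAB hx'A hxB

/-- Superordination: if `γ * ψ + z * ψ'` takes only values of the univalent function
`γ * q + z * q'`, then `ψ` is subordinate to `q`. At a first exit point `z₀` of `ψ` from `q (U)`,
the function `q⁻¹ ∘ ψ` tends to a boundary point `ζ`, and by Jack's lemma the boundary value of
`γ * q + z * q'` at `ζ` is an earlier chain member at `z₀`. By `ConvexUnivalent.exists_chain_eq` it
is a value of `γ * ψ + z * ψ'`, hence of `γ * q + z * q'`, against `Univalent.ne_of_tendsto`. -/
theorem ConvexUnivalent.subordinate_to_of_deriv {ψ q : ℂ → ℂ} (hψ : ConvexUnivalent ψ) {γ : ℂ}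
    (hγ : 0 ≤ γ.re) (hq : DifferentiableOn ℂ q U) (hQ : ClassQ q) (h0 : ψ 0 = q 0)
    (hF : Univalent fun z => γ * q z + z * deriv q z)
    (h : ∀ z ∈ U, ∃ y ∈ U, γ * ψ z + z * deriv ψ z = γ * q y + y * deriv q y) :
    Subordinate ψ q := by
  obtain ⟨g, hgq, hg, hginj, hgd⟩ := hQ
  have hUsub := U_subset_closedBall_diff q
  have hqinj : InjOn q U := (hginj.mono hUsub).congr hgq
  refine Univalent.subordinate_of_mapsTo_image ⟨hq, hqinj⟩ hψ.1.1 h0 fun z₁ hz₁ => ?_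
  by_contra hz₁V
  obtain ⟨z₀, hz00, hz₀z₁, hz₀V, -, hin⟩ := exists_first_exit
    (isOpen_image_of_injOn isOpen_U hq hqinj) hψ.1.1.continuousOn
    (h0 ▸ mem_image_of_mem q zero_mem_U) hz₁ hz₁V
  have hz₀U : z₀ ∈ U := mem_U_iff.2 (hz₀z₁.trans_lt (mem_U_iff.1 hz₁))
  obtain ⟨k, hk, hkd⟩ := exists_hasDerivAt_leftInverse_of_injOn isOpen_U hq hqinj
  set w : ℂ → ℂ := fun z => k (ψ z) with hw
  have hwball : ∀ z ∈ Metric.ball (0 : ℂ) ‖z₀‖, DifferentiableAt ℂ w z ∧ w z ∈ U ∧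
      q (w z) = ψ z := by
    intro z hz
    obtain ⟨y, hy, hyz⟩ := hin z (by simpa using hz)
    have h1 := (hkd y hy).differentiableAt
    rw [hyz] at h1
    have hzU : z ∈ U := mem_U_iff.2
      ((show ‖z‖ < ‖z₀‖ by simpa using hz).trans (mem_U_iff.1 hz₀U))
    refine ⟨h1.comp z (hψ.1.1.differentiableAt (isOpen_U.mem_nhds hzU)), ?_⟩
    simp only [hw, ← hyz, hk y hy]
    exact ⟨hy, trivial⟩
  have hw00 : w 0 = 0 := by simp only [hw, h0, hk 0 zero_mem_U]
  have hwschwarz : ∀ z, ‖z‖ < ‖z₀‖ → ‖w z‖ * ‖z₀‖ ≤ 1 * ‖z‖ := by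
    intro z hz
    have := Complex.dist_le_div_mul_dist_of_mapsTo_ball (f := w) (R₂ := 1)
      (fun x hx => (hwball x hx).1.differentiableWithinAt)
      (fun x hx => by rw [hw00]; exact Metric.ball_subset_closedBall (hwball x hx).2.1)
      (show z ∈ Metric.ball (0 : ℂ) ‖z₀‖ by simpa using hz)
    rwa [hw00, dist_zero_right, dist_zero_right, div_mul_eq_mul_div,
      le_div_iff₀ (norm_pos_iff.2 hz00)] at this
  set l : Filter ℂ := 𝓝[Metric.ball 0 ‖z₀‖] z₀ with hl
  have hlne : l.NeBot := by
    rw [hl, ← mem_closure_iff_nhdsWithin_neBot, closure_ball _ (norm_pos_iff.2 hz00).ne']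
    simp
  have hψd := (hψ.1.1.differentiableAt (isOpen_U.mem_nhds hz₀U))
  have hlw : ∀ᶠ z in l, w z ∈ U := by
    filter_upwards [self_mem_nhdsWithin] with z hz using (hwball z hz).2.1
  have hlq : Tendsto (fun z => q (w z)) l (𝓝 (ψ z₀)) := by
    refine (hψd.continuousAt.tendsto.mono_left nhdsWithin_le_nhds).congr' ?_
    filter_upwards [self_mem_nhdsWithin] with z hz using (hwball z hz).2.2.symm
  have hlw' : ∀ᶠ z in l, w z ∈ Metric.closedBall (0 : ℂ) 1 :=
    hlw.mono fun z hz => Metric.ball_subset_closedBall hz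
  -- the injectivity of `g` on the boundary makes the cluster point of `w` at `z₀` unique
  have hclus : ∀ y, MapClusterPt y l w →
      y ∈ Metric.sphere (0 : ℂ) 1 \ exceptionalSet q ∧ g y = ψ z₀ := by
    intro y hy
    obtain ⟨u, hu, huy⟩ := mapClusterPt_iff_ultrafilter.1 hy
    exact mem_sphere_diff_of_tendsto hgq hg (hlw.filter_mono hu) huy (hlq.mono_left hu) hz₀V
  obtain ⟨ζ, -, hζcl⟩ := (isCompact_closedBall (0 : ℂ) 1).exists_mapClusterPt
    (show map w l ≤ 𝓟 (Metric.closedBall 0 1) from le_principal_iff.2 hlw')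
  obtain ⟨hζ, hgζ⟩ := hclus ζ hζcl
  have hss : Metric.sphere (0 : ℂ) 1 \ exceptionalSet q ⊆
      Metric.closedBall (0 : ℂ) 1 \ exceptionalSet q :=
    sdiff_subset_sdiff_left Metric.sphere_subset_closedBall
  have hwζ : Tendsto w l (𝓝 ζ) :=
    (isCompact_closedBall (0 : ℂ) 1).tendsto_nhds_of_unique_mapClusterPt hlw' fun y _ hy =>
      hginj (hss (hclus y hy).1) (hss hζ) ((hclus y hy).2.trans hgζ.symm)
  -- `v` extends `w` analytically across `z₀`, by means of the local inverse of `g` at `ζ`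
  have hgs := (hg ζ (hss hζ)).hasStrictDerivAt
  have hgd0 := hgd ζ hζ
  set v : ℂ → ℂ := fun z => hgs.localInverse g _ ζ hgd0 (ψ z) with hv
  have hv0 : v z₀ = ζ := by
    have := (hgs.hasStrictFDerivAt_equiv hgd0).eventually_left_inverse.self_of_nhds
    simp only [hv, ← hgζ]
    exact this
  have hvd : HasDerivAt v ((deriv g ζ)⁻¹ * deriv ψ z₀) z₀ := by
    have h1 := (hgs.to_localInverse hgd0).hasDerivAt
    rw [hgζ] at h1
    exact h1.comp z₀ hψd.hasDerivAt
  have hvw : ∀ᶠ z in l, v z = w z := by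
    have h1 := hwζ.eventually (hgs.hasStrictFDerivAt_equiv hgd0).eventually_left_inverse
    filter_upwards [h1, self_mem_nhdsWithin] with z hz hzb
    rw [hgq (hwball z hzb).2.1, (hwball z hzb).2.2] at hz
    exact hz
  have hζ1 : ‖ζ‖ = 1 := mem_sphere_zero_iff_norm.1 hζ.1
  have hζ0 : ζ ≠ 0 := norm_pos_iff.1 (hζ1 ▸ one_pos)
  obtain ⟨m, hm, hmv⟩ := exists_one_le_mul_deriv_eq hz00 hvd.differentiableAt (hv0 ▸ hζ0) (by
    filter_upwards [eventually_nhdsWithin_iff.1 hvw] with z hz hlt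
    rw [hz (by simpa using hlt), hv0, hζ1]
    exact hwschwarz z hlt)
  rw [hvd.deriv, hv0] at hmv
  have hm0 : (m : ℂ) ≠ 0 := by exact_mod_cast (one_pos.trans_le hm).ne'
  have hzψ : ζ * deriv g ζ = ((m⁻¹ : ℝ) : ℂ) * (z₀ * deriv ψ z₀) := by
    push_cast
    field_simp at hmv ⊢
    linear_combination -hmv
  obtain ⟨ξ, hξ, hξe⟩ := hψ.exists_chain_eq hγ (t := m⁻¹) (by positivity)
    (inv_le_one_of_one_le₀ hm) hz₀U
  obtain ⟨y, hy, hye⟩ := h ξ hξ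
  have hlim : Tendsto (fun z => γ * q z + z * deriv q z) (𝓝[U] ζ)
      (𝓝 (γ * g ζ + ζ * deriv g ζ)) := by
    have hga := hg ζ (hss hζ)
    have h1 : ContinuousAt (fun z => γ * g z + z * deriv g z) ζ :=
      (hga.continuousAt.const_mul γ).add (continuousAt_id.mul hga.deriv.continuousAt)
    refine (h1.tendsto.mono_left nhdsWithin_le_nhds).congr' ?_
    filter_upwards [self_mem_nhdsWithin] with z hz
    rw [hgq hz, (hgq.eventuallyEq_of_mem (isOpen_U.mem_nhds hz)).deriv_eq]
  refine hF.ne_of_tendsto hζ.1 hlim hy ?_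
  rw [hgζ, hzψ, ← hξe, hye]

/-! ### The first-order relation between `Ω` and `Φ` -/

/-- Functions of the class are `z ^ p` times an analytic function with value `1` at the origin. -/
theorem ClassA.exists_eventually_eq_pow_mul {p : ℕ} {f : ℂ → ℂ} (hf : ClassA p f) :
    ∃ R : ℂ → ℂ, AnalyticAt ℂ R 0 ∧ R 0 = 1 ∧ ∀ᶠ z in 𝓝 0, f z = z ^ p * R z := by
  obtain ⟨-, b, hb⟩ := hf
  set S : ℂ → ℂ := fun z => if z = 0 then b 0 else (f z - z ^ p) / z ^ (p + 1) with hS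
  have hSa : AnalyticAt ℂ S 0 := by
    refine ⟨FormalMultilinearSeries.ofScalars ℂ b, ?_⟩
    rw [hasFPowerSeriesAt_iff]
    filter_upwards [isOpen_U.mem_nhds zero_mem_U] with z hz
    rw [zero_add]
    simp only [FormalMultilinearSeries.coeff_ofScalars, smul_eq_mul]
    rcases eq_or_ne z 0 with rfl | hz0
    · have := hasSum_single (f := fun n : ℕ => (0 : ℂ) ^ n * b n) 0 (by
        intro n hn
        simp [hn])
      simpa [hS] using this
    · have h1 := (hb z hz).div_const (z ^ (p + 1))
      simp only [hS, hz0, if_false]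
      refine h1.congr_fun ?_
      intro n
      rw [pow_add]
      field_simp
  refine ⟨fun z => 1 + z * S z, analyticAt_const.add (analyticAt_id.mul hSa), by simp, ?_⟩
  filter_upwards [isOpen_U.mem_nhds zero_mem_U] with z hz
  rcases eq_or_ne z 0 with rfl | hz0
  · have := (hb 0 hz).unique (hasSum_zero.congr_fun fun k => by simp)
    simpa [sub_eq_zero] using this
  · simp only [hS, hz0, if_false]
    field_simp
    ring

/-- In terms of the normalized functions `R = f / z ^ p`, the recurrence of `ClassO` reads
`z * R_a' = α_a * (R_{a+1} - R_a)`. -/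
theorem ClassO.mul_deriv_eq {p : ℕ} {L : ℂ → (ℂ → ℂ) → (ℂ → ℂ)} {α : ℂ → ℂ} (hL : ClassO p L α)
    {f : ℂ → ℂ} (hf : ClassA p f) (a : ℂ) {R R' : ℂ → ℂ} (hR : AnalyticAt ℂ R 0)
    (hRe : ∀ᶠ z in 𝓝 0, L a f z = z ^ p * R z)
    (hRe' : ∀ᶠ z in 𝓝 0, L (a + 1) f z = z ^ p * R' z) :
    ∀ᶠ z in 𝓝[≠] 0, z * deriv R z = α a * (R' z - R z) := by
  filter_upwards [hRe.eventually_nhds.filter_mono nhdsWithin_le_nhds,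
    hRe'.filter_mono nhdsWithin_le_nhds, hR.eventually_analyticAt.filter_mono nhdsWithin_le_nhds,
    mem_nhdsWithin_of_mem_nhds (isOpen_U.mem_nhds zero_mem_U), self_mem_nhdsWithin]
    with z h1 h2 h3 h4 (h5 : z ≠ 0)
  have hd : deriv (L a f) z = p * z ^ (p - 1) * R z + z ^ p * deriv R z := by
    have h6 : L a f =ᶠ[𝓝 z] fun z => z ^ p * R z := h1
    rw [h6.deriv_eq]
    exact ((hasDerivAt_pow p z).mul h3.differentiableAt.hasDerivAt).deriv
  have hrec := hL.recurrence a f hf z h4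
  rw [hd, h1.self_of_nhds, h2] at hrec
  have hpz : z * (p * z ^ (p - 1) * R z) = p * z ^ p * R z := by
    rcases Nat.eq_zero_or_pos p with rfl | hp
    · simp
    · obtain ⟨n, rfl⟩ := Nat.exists_eq_succ_of_ne_zero hp.ne'
      simp only [Nat.succ_eq_add_one, Nat.add_sub_cancel]
      ring
  have hzp : z ^ p ≠ 0 := pow_ne_zero p h5
  refine mul_left_cancel₀ hzp ?_
  rw [mul_add, hpz] at hrec
  linear_combination hrec

theorem omega_eventuallyEq_cpow {p : ℕ} {L : ℂ → (ℂ → ℂ) → (ℂ → ℂ)} {f : ℂ → ℂ} {a : ℂ}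
    {R R' : ℂ → ℂ} (hRe : ∀ᶠ z in 𝓝 0, L a f z = z ^ p * R z)
    (hRe' : ∀ᶠ z in 𝓝 0, L (a + 1) f z = z ^ p * R' z) (μ ν : ℝ) :
    ∀ᶠ z in 𝓝[≠] 0, omega p L μ ν a f z = R' z ^ (μ : ℂ) * (R z)⁻¹ ^ (ν : ℂ) := by
  filter_upwards [(omega_eventuallyEq p L μ ν a f).filter_mono nhdsWithin_le_nhds,
    hRe.filter_mono nhdsWithin_le_nhds, hRe'.filter_mono nhdsWithin_le_nhds, self_mem_nhdsWithin]
    with z h1 h2 h3 (h4 : z ≠ 0)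
  have hzp : z ^ p ≠ 0 := pow_ne_zero p h4
  rw [h1, principalOmega, if_neg h4, h2, h3, mul_div_cancel_left₀ _ hzp, div_mul_eq_div_div,
    div_self hzp, one_div]

theorem hasDerivAt_cpow_mul_inv_cpow {R R' : ℂ → ℂ} {z : ℂ} (hR : DifferentiableAt ℂ R z)
    (hR' : DifferentiableAt ℂ R' z) (h : (R z)⁻¹ ∈ Complex.slitPlane)
    (h' : R' z ∈ Complex.slitPlane) (μ ν : ℂ) :
    HasDerivAt (fun z => R' z ^ μ * (R z)⁻¹ ^ ν)
      (R' z ^ μ * (R z)⁻¹ ^ ν * (μ * deriv R' z / R' z - ν * deriv R z / R z)) z := by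
  have h0' : R' z ≠ 0 := Complex.slitPlane_ne_zero h'
  have h0 : R z ≠ 0 := fun h1 => Complex.slitPlane_ne_zero h (by rw [h1, inv_zero])
  have hd := (hR'.hasDerivAt.cpow_const (c := μ) h').mul
    ((hR.hasDerivAt.inv h0).cpow_const (c := ν) h)
  refine hd.congr_deriv ?_
  simp only [Pi.inv_apply]
  rw [Complex.cpow_sub _ _ h0', Complex.cpow_sub _ _ (inv_ne_zero h0), Complex.cpow_one,
    Complex.cpow_one]
  field_simp
  ring

/-- The logarithmic derivative of `Ω` gives `α_{a+1} Φ = γ Ω + z Ω'` with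
`γ = α_{a+1} μ - α_a ν`, near the origin and hence in the whole disk. -/
theorem mul_phi_eqOn {p : ℕ} {L : ℂ → (ℂ → ℂ) → (ℂ → ℂ)} {α : ℂ → ℂ} (hL : ClassO p L α)
    {μ ν : ℝ} {a : ℂ} (hα : α (a + 1) ≠ 0) {f : ℂ → ℂ} (hf : ClassA p f)
    (hΩ : DifferentiableOn ℂ (omega p L μ ν a f) U)
    (hΦ : DifferentiableOn ℂ (phi p L α μ ν a f) U) :
    EqOn (fun z => α (a + 1) * phi p L α μ ν a f z)
      (fun z => (α (a + 1) * μ - α a * ν) * omega p L μ ν a f z +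
        z * deriv (omega p L μ ν a f) z) U := by
  have hl : DifferentiableOn ℂ (fun z => α (a + 1) * phi p L α μ ν a f z) U := hΦ.const_mul _
  have hr : DifferentiableOn ℂ (fun z => (α (a + 1) * μ - α a * ν) * omega p L μ ν a f z +
        z * deriv (omega p L μ ν a f) z) U :=
    (hΩ.const_mul _).add (differentiableOn_id.mul (hΩ.deriv isOpen_U))
  refine (hl.analyticOnNhd isOpen_U).eqOn_of_preconnected_of_frequently_eq
    (hr.analyticOnNhd isOpen_U) isPreconnected_U zero_mem_U (Eventually.frequently ?_)
  obtain ⟨B, hBa, hB0, hB⟩ := (hL.mapsTo a f hf).exists_eventually_eq_pow_mul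
  obtain ⟨A, hAa, hA0, hA⟩ := (hL.mapsTo (a + 1) f hf).exists_eventually_eq_pow_mul
  obtain ⟨C, -, -, hC⟩ := (hL.mapsTo (a + 1 + 1) f hf).exists_eventually_eq_pow_mul
  have hAs : ∀ᶠ z in 𝓝[≠] 0, A z ∈ Complex.slitPlane :=
    (hAa.continuousAt.eventually_mem (Complex.isOpen_slitPlane.mem_nhds
      (by simp [hA0]))).filter_mono nhdsWithin_le_nhds
  have hBs : ∀ᶠ z in 𝓝[≠] 0, (B z)⁻¹ ∈ Complex.slitPlane :=
    ((hBa.continuousAt.inv₀ (by simp [hB0])).eventually_mem (Complex.isOpen_slitPlane.mem_nhds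
      (by simp [hB0]))).filter_mono nhdsWithin_le_nhds
  have hq := omega_eventuallyEq_cpow hB hA μ ν
  filter_upwards [eventually_eventually_nhdsWithin.2 hq, omega_eventuallyEq_cpow hB hA 1 1,
    omega_eventuallyEq_cpow hA hC 1 1, hL.mul_deriv_eq hf a hBa hB hA,
    hL.mul_deriv_eq hf (a + 1) hAa hA hC, hAs, hBs,
    hAa.eventually_analyticAt.filter_mono nhdsWithin_le_nhds,
    hBa.eventually_analyticAt.filter_mono nhdsWithin_le_nhds, self_mem_nhdsWithin]
    with z h1 h2 h3 h4 h5 h6 h7 h8 h9 (h10 : z ≠ 0)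
  have h1' : omega p L μ ν a f =ᶠ[𝓝 z] fun z => A z ^ (μ : ℂ) * (B z)⁻¹ ^ (ν : ℂ) := by
    rwa [nhdsWithin_eq_nhds.2 (isOpen_compl_singleton.mem_nhds h10)] at h1
  have hA0' : A z ≠ 0 := Complex.slitPlane_ne_zero h6
  have hB0' : B z ≠ 0 := fun h0 => Complex.slitPlane_ne_zero h7 (by rw [h0, inv_zero])
  simp only [Complex.ofReal_one, Complex.cpow_one] at h2 h3
  have h1z : omega p L μ ν a f z = A z ^ (μ : ℂ) * (B z)⁻¹ ^ (ν : ℂ) := h1'.self_of_nhds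
  rw [phi, upsilon, h2, h3, h1'.deriv_eq, h1z,
    (hasDerivAt_cpow_mul_inv_cpow h9.differentiableAt h8.differentiableAt h7 h6 _ _).deriv]
  generalize A z ^ (μ : ℂ) * (B z)⁻¹ ^ (ν : ℂ) = q
  have e1 : z * (q * (μ * deriv A z / A z - ν * deriv B z / B z)) =
      q * (μ * (z * deriv A z) / A z - ν * (z * deriv B z) / B z) := by ring
  rw [e1, h4, h5]
  field_simp
  ring

end Sandwich

theorem mainTheorem4 (p : ℕ) (hp : 1 ≤ p)
    (L : ℂ → (ℂ → ℂ) → (ℂ → ℂ)) (α : ℂ → ℂ) (hL : Sandwich.ClassO p L α)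
    (μ ν : ℝ) (hμν : ¬(μ = 0 ∧ ν = 0)) (a : ℂ)
    (hα : α (a + 1) ≠ 0) (hre : 0 ≤ (α (a + 1) * μ - α a * ν).re)
    (f : ℂ → ℂ) (hf : Sandwich.ClassA p f)
    (ψ₁ ψ₂ : ℂ → ℂ)
    (hψ₁ : Sandwich.ConvexUnivalent ψ₁) (hψ₁0 : ψ₁ 0 = 1)
    (hψ₂ : Sandwich.ConvexUnivalent ψ₂) (hψ₂0 : ψ₂ 0 = 1)
    (hΩ0 : ∀ z ∈ Sandwich.U, Sandwich.omega p L μ ν a f z ≠ 0)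
    (hΩH : Sandwich.ClassH 1 1 (Sandwich.omega p L μ ν a f))
    (hΩQ : Sandwich.ClassQ (Sandwich.omega p L μ ν a f))
    (hΦ : Sandwich.Univalent (Sandwich.phi p L α μ ν a f))
    (h₁ : Sandwich.Subordinate (Sandwich.chi α μ ν a ψ₁) (Sandwich.phi p L α μ ν a f))
    (h₂ : Sandwich.Subordinate (Sandwich.phi p L α μ ν a f) (Sandwich.chi α μ ν a ψ₂)) :
    Sandwich.Subordinate ψ₁ (Sandwich.omega p L μ ν a f) ∧
      Sandwich.Subordinate (Sandwich.omega p L μ ν a f) ψ₂ := by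
  have hE := Sandwich.mul_phi_eqOn hL hα hf hΩH.1 hΦ.1
  have hq0 : Sandwich.omega p L μ ν a f 0 = 1 := by
    rw [(Sandwich.omega_eventuallyEq p L μ ν a f).self_of_nhds]
    simp [Sandwich.principalOmega]
  have hχ : ∀ (ψ : ℂ → ℂ) (z : ℂ), α (a + 1) * Sandwich.chi α μ ν a ψ z =
      (α (a + 1) * μ - α a * ν) * ψ z + z * deriv ψ z := by
    intro ψ z
    rw [Sandwich.chi]
    field_simp
  constructor
  · obtain ⟨w, -, hw, hwe⟩ := h₁
    have hF : Sandwich.Univalent fun z => (α (a + 1) * μ - α a * ν) *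
        Sandwich.omega p L μ ν a f z + z * deriv (Sandwich.omega p L μ ν a f) z := by
      refine ⟨(hΦ.1.const_mul (α (a + 1))).congr fun z hz => (hE hz).symm, ?_⟩
      refine InjOn.congr (fun x hx y hy hxy => ?_) hE
      exact hΦ.2 hx hy (mul_left_cancel₀ hα hxy)
    refine hψ₁.subordinate_to_of_deriv hre hΩH.1 hΩQ (hψ₁0.trans hq0.symm) hF fun z hz => ?_
    have hwz : w z ∈ Sandwich.U :=
      Sandwich.mem_U_iff.2 ((hw z hz).trans_lt (Sandwich.mem_U_iff.1 hz))
    refine ⟨w z, hwz, ?_⟩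
    rw [← hχ ψ₁, hwe z hz]
    exact hE hwz
  · obtain ⟨w, -, hw, hwe⟩ := h₂
    refine hψ₂.subordinate_of_deriv hre hΩH.1 (hq0.trans hψ₂0.symm) fun z hz => ⟨w z, hw z hz, ?_⟩
    rw [← hχ ψ₂, ← hwe z hz]
    exact (hE hz).symm
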